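/- All balls are open and $\lambda B(x,r)=B(x,\lambda r)$. Let $(X,d,\mu)$ be a metric measure space, $1\le p<\infty$. A Borel function $g\ge 0$ is an upper gradient of $u:\Omega\to[-\infty,\infty]$ on $\Omega\subset X$ if $|u(\gamma(0))-u(\gamma(l))|\le\int_\gamma g\,ds$ for every nonconstant compact rectifiable curve $\gamma:[0,l]\to\Omega$ parameterized by arc length (the left-hand side being $\infty$ if one of the terms is infinite). The $p$-Poincaré inequality for the ball $B$, with constants $C>0$ and $\lambda\ge1$, says that $$\frac1{\mu(B)}\int_B|u-u_B|\,d\mu\le C r_B\Bigl(\frac1{\mu(\lambda B)}\int_{\lambda B}g^p\,d\mu\Bigr)^{1/p},\qquad u_B=\frac1{\mu(B)}\int_B u\,d\mu,$$ for all integrable $u$ on $\lambda B$ and all upper gradients $g$ of $u$ on $\lambda B$; here $r_B$ is the radius of $B$. It holds within $B_0$ if it holds for all balls $B\subset B_0$ with some $C$, $\lambda$ independent of $B$; $\mu$ supports a $p$-Poincaré inequality if $C$, $\lambda$ can be chosen independently of $B_0$ as well. Similarly, $\mu$ is doubling within $B_0$ if $\mu(2B)\le C\mu(B)$ for all balls $B\subset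 B_0$, and doubling if $C$ is independent of $B_0$. The measure is $p$-admissible within $B_0$ if it is doubling and satisfies a $p$-Poincaré inequality within $B_0$. A weight $w$ on $\mathbb R$ is an $A_p$ weight within an open interval $I_0$ if there is $C$ such that for all open intervals $B\subset I_0$, $$\frac1{|B|}\int_B w\,dx< C\Bigl(\frac1{|B|}\int_B w^{1/(1-p)}dx\Bigr)^{1-p}\ (p>1),\qquad \frac1{|B|}\int_B w\,dx< C\operatorname{ess\,inf}_B w\ (p=1).$$ Theorem. Let $\alpha\ge0$, $w(x)=x^\alpha$ on $[0,1]$ and $d\mu=w\,dx$, with $w$ and $\mu$ extended by $0$ to $\mathbb R$ where needed. (a) On the metric space $[0,1]$, $\mu$ is doubling and supports a $1$-Poincaré inequality with $C=2$ and $\lambda=1$. Moreover, the $1$-Poincaré inequality with $C=2$ and $\lambda=1$ holds for every interval $(a,b)\subset(0,1)$ (with $r_B=(b-a)/2$). (b) For every $1\le p<\infty$, $\mu$ (extended by $0$, the ambient space being $\mathbb R$) is $p$-admissible within $(0,1)$. (c) Let $1\le p<1+\alpha$. Then $w$ is not an $A_p$ weight within $(0,1)$. Moreover, let $\nu$ be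 any Borel measure on $\mathbb R$ such that all balls have positive and finite measure and $\nu|_{[0,1]}=\mu$. Then the $p$-Poincaré inequality for $\nu$ fails on $(-1,1)$ for all constants $C$ and $\lambda$, it does not hold within $(-r,r)$ for any $r>0$, and $\nu$ does not support a $p$-Poincaré inequality. In particular, admissibility within $(0,1)$ does not suffice for reflections: neither the measure $\hat w\,dx$ on $\mathbb R$, where $\hat w$ is the $2$-periodic extension of the even reflection of $w$, nor the measure $A\mapsto\mu(A\cap[0,1])+\mu((-A)\cap[0,1])$ on $[-1,1]$ with the endpoints $\pm1$ identified (a circle of length $2$ with its arc-length metric) supports a $p$-Poincaré inequality. -/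

import Mathlib

open MeasureTheory Set Metric
open scoped ENNReal

noncomputable section

/-- `g` is an upper gradient of the extended real-valued function `u` on the set `Ω` (viewed as a
metric space of its own). Nonconstant compact rectifiable curves in `Ω` are represented by their
arc-length parametrizations `γ : [0, l] → Ω` with `l > 0`, i.e. by maps of unit speed.
In `EReal` one has `(a - b).abs = ∞` as soon as `a` or `b` is infinite, which is the usual
convention for the left-hand side. -/
def IsUpperGradientOn {X : Type*} [MetricSpace X] [MeasurableSpace X]
    (g : X → ℝ≥0∞) (u : X → EReal) (Ω : Set X) : Prop :=
  Measurable g ∧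
    ∀ (l : ℝ) (γ : ℝ → X), 0 < l → HasUnitSpeedOn γ (Icc 0 l) → MapsTo γ (Icc 0 l) Ω →
      (u (γ 0) - u (γ l)).abs ≤ ∫⁻ t in Icc 0 l, g (γ t)

/-- An extended real-valued function is integrable on `s`: it is finite almost everywhere there and
its real-valued version is integrable. -/
def EIntegrableOn {X : Type*} [MeasurableSpace X] (u : X → EReal) (s : Set X) (μ : Measure X) :
    Prop :=
  (∀ᵐ y ∂(μ.restrict s), u y ≠ ⊤ ∧ u y ≠ ⊥) ∧ IntegrableOn (fun y => (u y).toReal) s μ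

/-- The mean value `u_s` of `u` over `s`. -/
def meanOn {X : Type*} [MeasurableSpace X] (u : X → EReal) (s : Set X) (μ : Measure X) : ℝ :=
  ⨍ y in s, (u y).toReal ∂μ

/-- The `p`-Poincaré inequality on the single ball `B = B(x, r)` with constant `C` and dilation
constant `lam`. -/
def PoincareOnBall {X : Type*} [MetricSpace X] [MeasurableSpace X]
    (μ : Measure X) (p C lam : ℝ) (x : X) (r : ℝ) : Prop :=
  ∀ (u : X → EReal) (g : X → ℝ≥0∞),
    EIntegrableOn u (ball x (lam * r)) μ → IsUpperGradientOn g u (ball x (lam * r)) →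
      ⨍⁻ y in ball x r, (u y - (meanOn u (ball x r) μ : EReal)).abs ∂μ
        ≤ ENNReal.ofReal (C * r) * (⨍⁻ y in ball x (lam * r), g y ^ p ∂μ) ^ (1 / p)

/-- The `p`-Poincaré inequality holds within `B(x₀, r₀)` with constants `C` and `lam`. -/
def PoincareWithinWith {X : Type*} [MetricSpace X] [MeasurableSpace X]
    (μ : Measure X) (p C lam : ℝ) (x₀ : X) (r₀ : ℝ) : Prop :=
  ∀ (x : X) (r : ℝ), 0 < r → ball x r ⊆ ball x₀ r₀ → PoincareOnBall μ p C lam x r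

/-- The `p`-Poincaré inequality holds within `B(x₀, r₀)`. -/
def PoincareWithin {X : Type*} [MetricSpace X] [MeasurableSpace X]
    (μ : Measure X) (p : ℝ) (x₀ : X) (r₀ : ℝ) : Prop :=
  ∃ C lam : ℝ, 0 < C ∧ 1 ≤ lam ∧ PoincareWithinWith μ p C lam x₀ r₀

/-- The (global) `p`-Poincaré inequality with constants `C` and `lam`. -/
def SupportsPoincareWith {X : Type*} [MetricSpace X] [MeasurableSpace X]
    (μ : Measure X) (p C lam : ℝ) : Prop :=
  ∀ (x₀ : X) (r₀ : ℝ), 0 < r₀ → PoincareWithinWith μ p C lam x₀ r₀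

/-- `μ` supports a (global) `p`-Poincaré inequality. -/
def SupportsPoincare {X : Type*} [MetricSpace X] [MeasurableSpace X]
    (μ : Measure X) (p : ℝ) : Prop :=
  ∃ C lam : ℝ, 0 < C ∧ 1 ≤ lam ∧ SupportsPoincareWith μ p C lam

/-- `μ` is doubling within `B(x₀, r₀)` with constant `C`. -/
def DoublingWithinWith {X : Type*} [MetricSpace X] [MeasurableSpace X]
    (μ : Measure X) (C : ℝ) (x₀ : X) (r₀ : ℝ) : Prop :=
  ∀ (x : X) (r : ℝ), 0 < r → ball x r ⊆ ball x₀ r₀ →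
    μ (ball x (2 * r)) ≤ ENNReal.ofReal C * μ (ball x r)

/-- `μ` is doubling within `B(x₀, r₀)`. -/
def DoublingWithin {X : Type*} [MetricSpace X] [MeasurableSpace X]
    (μ : Measure X) (x₀ : X) (r₀ : ℝ) : Prop :=
  ∃ C : ℝ, 0 < C ∧ DoublingWithinWith μ C x₀ r₀

/-- `μ` is (globally) doubling. -/
def IsDoubling {X : Type*} [MetricSpace X] [MeasurableSpace X] (μ : Measure X) : Prop :=
  ∃ C : ℝ, 0 < C ∧ ∀ (x₀ : X) (r₀ : ℝ), 0 < r₀ → DoublingWithinWith μ C x₀ r₀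

/-- `μ` is `p`-admissible within `B(x₀, r₀)`. -/
def AdmissibleWithin {X : Type*} [MetricSpace X] [MeasurableSpace X]
    (μ : Measure X) (p : ℝ) (x₀ : X) (r₀ : ℝ) : Prop :=
  DoublingWithin μ x₀ r₀ ∧ PoincareWithin μ p x₀ r₀

/-- Every ball has positive and finite measure. -/
def PosFiniteOnBalls {X : Type*} [MetricSpace X] [MeasurableSpace X] (μ : Measure X) : Prop :=
  ∀ (x : X) (r : ℝ), 0 < r → 0 < μ (ball x r) ∧ μ (ball x r) < ∞

/-- `w` is an `A_p` weight within the interval `B(x₀, r₀)` of the real line, `1 ≤ p < ∞`. In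
`ℝ≥0∞` one has `0 ^ (1 / (1 - p)) = ∞` and `∞ ^ (1 - p) = 0` for `p > 1`. -/
def IsApWeightWithin (w : ℝ → ℝ≥0∞) (p : ℝ) (x₀ r₀ : ℝ) : Prop :=
  ∃ C : ℝ, 0 < C ∧ ∀ x r : ℝ, 0 < r → ball x r ⊆ ball x₀ r₀ →
    (⨍⁻ y in ball x r, w y ∂volume) <
      ENNReal.ofReal C *
        (if p = 1 then essInf w (volume.restrict (ball x r))
         else (⨍⁻ y in ball x r, w y ^ (1 / (1 - p)) ∂volume) ^ (1 - p))

/-- The weight `x ^ α` on `[0, 1]`, extended by `0` to the real line. -/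
def powerWeight (α : ℝ) : ℝ → ℝ≥0∞ :=
  (Icc (0 : ℝ) 1).indicator (fun x => ENNReal.ofReal (x ^ α))

/-- The measure `x ^ α dx` on `[0, 1]`, extended by `0` to the real line. -/
def powerMeasure (α : ℝ) : Measure ℝ := volume.withDensity (powerWeight α)

/-- The measure `x ^ α dx` on the metric space `[0, 1]`. -/
def powerMeasureUnit (α : ℝ) : Measure (Icc (0 : ℝ) 1) :=
  (powerMeasure α).comap Subtype.val

/-- The `2M`-periodic extension to the real line of the even reflection of `w|_[0, M]`: it equals
`w (x - 2kM)` on `[2kM, (2k+1)M]` and `w (2kM - x)` on `[(2k-1)M, 2kM]`, `k ∈ ℤ`. -/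
def periodicReflection (w : ℝ → ℝ≥0∞) (M : ℝ) (x : ℝ) : ℝ≥0∞ :=
  if x - 2 * M * ⌊x / (2 * M)⌋ ≤ M then w (x - 2 * M * ⌊x / (2 * M)⌋)
  else w (2 * M - (x - 2 * M * ⌊x / (2 * M)⌋))

/-- The measure `A ↦ μ (A ∩ [0, M]) + μ (-A ∩ [0, M])` on `[-M, M]`, with the endpoints `±M`
identified: a measure on the circle `ℝ / 2Mℤ`, which carries its arc-length metric. -/
def circleReflection (μ : Measure ℝ) (M : ℝ) : Measure (AddCircle (2 * M)) :=
  Measure.map (fun x : ℝ => (x : AddCircle (2 * M)))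
    (μ.restrict (Icc 0 M) + (μ.restrict (Icc 0 M)).map (fun x => -x))

end

/-! The negative results rest on one family of test pairs. Let `h` be 1-Lipschitz, let `u` be the
indicator of `{h > 0}`, and let `g = ε / h` where `0 < h < 1`, zero elsewhere. A curve that passes
from `h ≤ 0` to `h > 0` has a last parameter `c` with `h ≤ 0`, after which `h ≤ |τ - c|`. Hence `∫ g
ds` dominates the divergent integral of `ε / |τ - c|`, and `g` is an upper gradient of `u` for every
`ε > 0`. Against `x ^ α dx` the energy of `g` is `ε ^ p` times the integral of `s ^ (α - p)` over
`(0, 1)`, finite exactly when `p < 1 + α`. As `ε → 0` the right-hand side of the Poincaré inequality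
tends to zero while the left-hand side stays fixed; the latter is positive once both `{h > 0}` and
`{h ≤ 0}` have positive measure in the ball (`not_poincareOnBall_of_lintegral_truncInv`).

For the positive results, bound `|u - u_B|` by the average of `|u(x) - u(y)|` over `y`, and that by
the integral of `g` between `x` and `y`. Fubini (`lintegral_lintegral_le_of_le_lintegral_uIoc`)
leaves `g(t)` weighted by twice the product of the masses to the left and to the right of `t`. The
1-Poincaré inequality with constant 2 thus follows from `2 μ(S ∩ (-∞, t)) μ(S ∩ [t, ∞)) ≤ (b - a)
w(t) μ(S)` (`two_mul_powerMeasure_mul_le`), which comes down to a Bernoulli-type inequality. Hölder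
gives all `p ≥ 1`, and doubling follows by comparing the weight near the centre with its largest
value on the doubled ball. -/

/-! ### Upper gradients of arbitrarily small energy for an indicator function -/

/-- The function `ε / s` on `(0, 1)`, extended by zero. -/
noncomputable def truncInv (ε : ℝ) : ℝ → ℝ≥0∞ :=
  (Ioo (0 : ℝ) 1).indicator (fun s => ENNReal.ofReal (ε * s⁻¹))

theorem measurable_truncInv (ε : ℝ) : Measurable (truncInv ε) :=
  (by fun_prop : Measurable fun s : ℝ => ENNReal.ofReal (ε * s⁻¹)).indicator measurableSet_Ioo

theorem truncInv_eq {ε : ℝ} (hε : 0 ≤ ε) (s : ℝ) :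
    truncInv ε s = ENNReal.ofReal ε * truncInv 1 s := by
  unfold truncInv
  by_cases hs : s ∈ Ioo (0 : ℝ) 1
  · simp [hs, ENNReal.ofReal_mul hε]
  · simp [hs]

theorem lintegral_enorm_sub_inv_eq_top {c d : ℝ} (h : c ≠ d) :
    ∫⁻ t in uIoc c d, ‖(t - c)⁻¹‖ₑ = ∞ := by
  by_contra hne
  have h1 : IntervalIntegrable (fun x : ℝ => (x - c)⁻¹) volume c d := by
    rw [intervalIntegrable_iff]
    exact ⟨by fun_prop, lt_top_iff_ne_top.2 hne⟩
  rw [intervalIntegrable_sub_inv_iff] at h1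
  rcases h1 with h1 | h1
  · exact h h1
  · exact h1 left_mem_uIcc

/-- The point `c` is the one nearest to `t` in a compact set of nonpositive points. Measuring by `|τ
- t|` treats both orders of `s` and `t` at once. -/
theorem exists_last_nonpos {f : ℝ → ℝ} {s t : ℝ} (hf : ContinuousOn f (uIcc s t))
    (hs : f s ≤ 0) : ∃ c ∈ uIcc s t, f c ≤ 0 ∧ ∀ τ ∈ uIcc c t, |τ - t| < |c - t| → 0 < f τ := by
  have hc : IsCompact (uIcc s t ∩ f ⁻¹' Iic 0) :=
    isCompact_uIcc.of_isClosed_subset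
      (hf.preimage_isClosed_of_isClosed isClosed_Icc isClosed_Iic) inter_subset_left
  obtain ⟨c, ⟨hc1, hc2⟩, hmin⟩ := hc.exists_isMinOn ⟨s, left_mem_uIcc, hs⟩
    (f := fun τ => |τ - t|) (by fun_prop)
  refine ⟨c, hc1, hc2, fun τ hτ hlt => ?_⟩
  by_contra hneg
  have := hmin (show τ ∈ uIcc s t ∩ f ⁻¹' Iic 0 from
    ⟨uIcc_subset_uIcc hc1 right_mem_uIcc hτ, not_lt.1 hneg⟩)
  simp only [mem_ofPred_eq] at this
  linarith

theorem lintegral_truncInv_comp_eq_top {f : ℝ → ℝ} {l s t ε : ℝ} (hε : 0 < ε)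
    (hf : LipschitzOnWith 1 f (Icc 0 l)) (hs : s ∈ Icc 0 l) (ht : t ∈ Icc 0 l)
    (hfs : f s ≤ 0) (hft : 0 < f t) : ∫⁻ τ in Icc 0 l, truncInv ε (f τ) = ∞ := by
  have hst : uIcc s t ⊆ Icc 0 l := uIcc_subset_Icc hs ht
  obtain ⟨c, hc, hfc, hpos⟩ := exists_last_nonpos (hf.continuousOn.mono hst) hfs
  have hct : c ≠ t := by rintro rfl; linarith
  have hct' : 0 < |t - c| := abs_pos.2 (sub_ne_zero.2 hct.symm)
  -- `δ < 1` keeps `d` strictly between `c` and `t`, where `f > 0`; `|t - c| * δ < 1` keeps `f < 1`,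
  -- so that `truncInv ε` equals `ε / s` there.
  obtain ⟨δ, hδ0, hδ1, hδ2⟩ : ∃ δ : ℝ, 0 < δ ∧ δ < 1 ∧ |t - c| * δ < 1 := by
    refine ⟨1 / (2 + |t - c|), by positivity, ?_, ?_⟩
    · rw [div_lt_one (by positivity)]; linarith
    · rw [mul_one_div, div_lt_one (by positivity)]; linarith
  set d := c + (t - c) * δ with hd
  have hcd : c ≠ d := by
    intro h
    have : (t - c) * δ = 0 := by linarith
    rcases mul_eq_zero.1 this with h | h
    · exact hct (by linarith)
    · linarith
  have hcl : c ∈ Icc 0 l := hst hc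
  have hdist : ∀ τ ∈ uIoc c d, τ ∈ uIcc c t ∧ |τ - c| < 1 ∧ (τ ≠ c → |τ - t| < |c - t|) := by
    intro τ hτ
    rcases lt_or_gt_of_ne hct with h | h
    · have h0 : |t - c| = t - c := abs_of_pos (by linarith)
      rw [h0] at hδ2
      have h1 : 0 < (t - c) * δ := mul_pos (by linarith) hδ0
      have h2 : (t - c) * δ < (t - c) := by nlinarith
      rw [uIoc_of_le (by linarith)] at hτ
      refine ⟨?_, ?_, fun _ => ?_⟩
      · rw [uIcc_of_le h.le]; exact ⟨hτ.1.le, by linarith [hτ.2]⟩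
      · rw [abs_of_pos (by linarith [hτ.1])]; linarith [hτ.2]
      · rw [abs_of_neg (by linarith [hτ.2]), abs_of_neg (by linarith)]; linarith [hτ.1]
    · have h0 : |t - c| = -(t - c) := abs_of_neg (by linarith)
      rw [h0] at hδ2
      have h1 : 0 < (c - t) * δ := mul_pos (by linarith) hδ0
      have h2 : (c - t) * δ < (c - t) := by nlinarith
      rw [uIoc_of_ge (by linarith)] at hτ
      refine ⟨?_, ?_, fun hne => ?_⟩
      · rw [uIcc_of_ge h.le]; exact ⟨by linarith [hτ.1], hτ.2⟩
      · rw [abs_of_nonpos (by linarith [hτ.2])]; linarith [hτ.1]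
      · rw [abs_of_pos (by linarith [hτ.1]), abs_of_pos (by linarith)]
        linarith [lt_of_le_of_ne hτ.2 hne]
  have hsub : uIoc c d ⊆ Icc 0 l := fun τ hτ =>
    uIcc_subset_Icc hcl ht (hdist τ hτ).1
  rw [eq_top_iff]
  calc ∞ = ENNReal.ofReal ε * ∫⁻ τ in uIoc c d, ‖(τ - c)⁻¹‖ₑ := by
        rw [lintegral_enorm_sub_inv_eq_top hcd, ENNReal.mul_top (by simpa using hε)]
    _ = ∫⁻ τ in uIoc c d, ENNReal.ofReal ε * ‖(τ - c)⁻¹‖ₑ := by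
        rw [lintegral_const_mul' _ _ ENNReal.ofReal_ne_top]
    _ ≤ ∫⁻ τ in uIoc c d, truncInv ε (f τ) := by
        refine setLIntegral_mono' measurableSet_uIoc fun τ hτ => ?_
        obtain ⟨h1, h2, h3⟩ := hdist τ hτ
        -- When `t < c` the half-open interval contains `c` itself; there the bound is trivial
        -- because `0⁻¹ = 0`.
        by_cases hτc : τ = c
        · simp [hτc]
        have hfτ := hpos τ h1 (h3 hτc)
        have hle : f τ ≤ |τ - c| := by
          have := hf.dist_le_mul τ (hsub hτ) c hcl
          rw [Real.dist_eq, Real.dist_eq] at this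
          have h4 := le_abs_self (f τ - f c)
          simp only [NNReal.coe_one, one_mul] at this
          linarith
        rw [truncInv, indicator_of_mem (show f τ ∈ Ioo (0 : ℝ) 1 from ⟨hfτ, by linarith⟩),
          ENNReal.ofReal_mul hε.le, ← ofReal_norm, norm_inv, Real.norm_eq_abs]
        gcongr
    _ ≤ _ := lintegral_mono_set hsub

/-- Distance between endpoints is at most the variation, which for unit speed is the length of the
parameter interval. -/
theorem HasUnitSpeedOn.lipschitzOnWith {X : Type*} [PseudoEMetricSpace X] {γ : ℝ → X} {s : Set ℝ}
    (h : HasUnitSpeedOn γ s) : LipschitzOnWith 1 γ s := by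
  have key : ∀ x ∈ s, ∀ y ∈ s, x ≤ y → edist (γ x) (γ y) ≤ edist x y := by
    intro x hx y hy hxy
    have h1 := h hx hy
    refine (eVariationOn.edist_le γ (s := s ∩ Icc x y) ⟨hx, le_rfl, hxy⟩ ⟨hy, hxy, le_rfl⟩).trans ?_
    rw [h1, edist_comm, edist_dist, Real.dist_eq, abs_of_nonneg (by linarith)]
    simp
  intro x hx y hy
  rw [ENNReal.coe_one, one_mul]
  rcases le_total x y with hxy | hxy
  · exact key x hx y hy hxy
  · rw [edist_comm, edist_comm x]; exact key y hy x hx hxy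

theorem isUpperGradientOn_truncInv {X : Type*} [MetricSpace X] [MeasurableSpace X] {h : X → ℝ}
    (hm : Measurable h) {Ω : Set X} (hh : LipschitzOnWith 1 h Ω) {ε : ℝ} (hε : 0 < ε) :
    IsUpperGradientOn (fun x => truncInv ε (h x)) ({x | 0 < h x}.indicator fun _ => (1 : EReal))
      Ω := by
  refine ⟨(measurable_truncInv ε).comp hm, fun l γ hl hγ hmaps => ?_⟩
  have hf : LipschitzOnWith 1 (h ∘ γ) (Icc 0 l) := by
    simpa using hh.comp hγ.lipschitzOnWith hmaps
  have h0 : (0 : ℝ) ∈ Icc 0 l := ⟨le_rfl, hl.le⟩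
  have h1 : l ∈ Icc 0 l := ⟨hl.le, le_rfl⟩
  by_cases ha : 0 < h (γ 0) <;> by_cases hb : 0 < h (γ l)
  · have : ((1 : EReal) - 1) = 0 := by
      rw [← EReal.coe_one, ← EReal.coe_sub, sub_self, EReal.coe_zero]
    simp [ha, hb, this]
  · rw [show (∫⁻ t in Icc 0 l, truncInv ε (h (γ t))) = ∞ from
      lintegral_truncInv_comp_eq_top hε hf h1 h0 (not_lt.1 hb) ha]
    exact le_top
  · rw [show (∫⁻ t in Icc 0 l, truncInv ε (h (γ t))) = ∞ from
      lintegral_truncInv_comp_eq_top hε hf h0 h1 (not_lt.1 ha) hb]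
    exact le_top
  · simp [ha, hb]

/-- The function `u` does not depend on `ε`, whereas its upper gradient is proportional to `ε` and
has finite `p`-energy; letting `ε → 0` forces the mean oscillation of `u` to vanish. -/
theorem not_poincareOnBall_of_lintegral_truncInv {X : Type*} [MetricSpace X] [MeasurableSpace X]
    [OpensMeasurableSpace X] {ν : Measure X} {h : X → ℝ} (hm : Measurable h) {x : X}
    {p C lam r : ℝ} (hp : 1 ≤ p) (hlam : 1 ≤ lam) (hr : 0 < r)
    (hh : LipschitzOnWith 1 h (ball x (lam * r))) (hfin : ν (ball x (lam * r)) < ∞)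
    (hpos : 0 < ν (ball x r ∩ {y | 0 < h y})) (hneg : 0 < ν (ball x r ∩ {y | h y ≤ 0}))
    (hint : ∫⁻ y in ball x (lam * r), truncInv 1 (h y) ^ p ∂ν < ∞) :
    ¬ PoincareOnBall ν p C lam x r := by
  intro hP
  set A := {y | 0 < h y} with hA
  have hAm : MeasurableSet A := measurableSet_lt measurable_const hm
  set u : X → EReal := A.indicator fun _ => (1 : EReal) with hu
  have hu_real : (fun y => (u y).toReal) = A.indicator fun _ => (1 : ℝ) := by
    ext y
    by_cases hy : y ∈ A <;> simp [hu, hy]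
  have hui : EIntegrableOn u (ball x (lam * r)) ν := by
    refine ⟨Filter.Eventually.of_forall fun y => ?_, ?_⟩
    · by_cases hy : y ∈ A
      · simpa [hu, hy] using ⟨EReal.coe_ne_top 1, EReal.coe_ne_bot 1⟩
      · simp [hu, hy]
    · rw [hu_real]
      have : IntegrableOn (fun _ => (1 : ℝ)) (ball x (lam * r)) ν := by
        simp [integrableOn_const_iff, hfin]
      exact this.indicator hAm
  have hsub : ball x r ⊆ ball x (lam * r) := ball_subset_ball (by nlinarith)
  have hfin' : ν (ball x r) < ∞ := (measure_mono hsub).trans_lt hfin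
  have hpos' : 0 < ν (ball x r) := hpos.trans_le (measure_mono inter_subset_left)
  set L := ⨍⁻ y in ball x r, (u y - (meanOn u (ball x r) ν : EReal)).abs ∂ν with hL
  have hLpos : 0 < L := by
    rw [hL, setLAverage_eq, ENNReal.div_pos_iff]
    refine ⟨fun h0 => ?_, hfin'.ne⟩
    set m := meanOn u (ball x r) ν
    have hmeas : Measurable fun y => (u y - (m : EReal)).abs := by
      have : (fun y => (u y - (m : EReal)).abs) =
          A.piecewise (fun _ => (1 - (m : EReal)).abs) (fun _ => (0 - (m : EReal)).abs) := by
        ext y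
        by_cases hy : y ∈ A <;> simp [hu, hy]
      rw [this]
      exact measurable_const.piecewise hAm measurable_const
    rw [lintegral_eq_zero_iff hmeas, Filter.EventuallyEq, ae_iff] at h0
    simp only [Pi.zero_apply] at h0
    -- A constant `m` cannot equal both values of `u`: if `m = 0` it misses the value 1 on `A`,
    -- otherwise the value 0 on the complement.
    by_cases hm0 : m = 0
    · have : ν (ball x r ∩ A) = 0 := by
        rw [inter_comm, ← Measure.restrict_apply hAm]
        refine measure_mono_null (fun y hy => ?_) h0
        simp [hu, hy, hm0]
      exact hpos.ne' this
    · have hcm : {y | h y ≤ 0} = Aᶜ := by ext y; simp [hA]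
      have : ν (ball x r ∩ {y | h y ≤ 0}) = 0 := by
        rw [hcm, inter_comm, ← Measure.restrict_apply hAm.compl]
        refine measure_mono_null (fun y hy => ?_) h0
        have hy' : y ∉ A := hy
        simp [hu, hy', hm0, EReal.abs_eq_zero_iff]
      exact hneg.ne' this
  set K := (⨍⁻ y in ball x (lam * r), truncInv 1 (h y) ^ p ∂ν) ^ (1 / p) with hK
  have hKfin : K ≠ ∞ := by
    refine ENNReal.rpow_ne_top_of_nonneg (by positivity) ?_
    rw [setLAverage_eq]
    exact (ENNReal.div_lt_top hint.ne (hpos'.trans_le (measure_mono hsub)).ne').ne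
  have hle : ∀ ε : ℝ, 0 < ε → L ≤ ENNReal.ofReal ε * (ENNReal.ofReal (C * r) * K) := by
    intro ε hε
    refine (hP u _ hui (isUpperGradientOn_truncInv hm hh hε)).trans_eq ?_
    have : ∀ y, truncInv ε (h y) ^ p = ENNReal.ofReal ε ^ p * truncInv 1 (h y) ^ p := fun y => by
      rw [truncInv_eq hε.le, ENNReal.mul_rpow_of_nonneg _ _ (by linarith)]
    simp_rw [this]
    rw [laverage_eq, lintegral_const_mul' _ _
      (ENNReal.rpow_ne_top_of_nonneg (by linarith) ENNReal.ofReal_ne_top), mul_div_assoc,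
      ← laverage_eq, ENNReal.mul_rpow_of_nonneg _ _ (by positivity), ← ENNReal.rpow_mul,
      mul_one_div_cancel (by linarith), ENNReal.rpow_one]
    ring
  set D := ENNReal.ofReal (C * r) * K with hD
  have hDfin : D ≠ ∞ := ENNReal.mul_ne_top ENNReal.ofReal_ne_top hKfin
  have hlim : Filter.Tendsto (fun ε : ℝ => ENNReal.ofReal ε * D) (nhdsWithin 0 (Ioi 0))
      (nhds 0) := by
    have h1 : Filter.Tendsto (fun ε : ℝ => ENNReal.ofReal ε) (nhdsWithin 0 (Ioi 0)) (nhds 0) := by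
      have := (ENNReal.continuous_ofReal.tendsto 0).mono_left
        (nhdsWithin_le_nhds (s := Ioi (0 : ℝ)))
      simpa using this
    simpa using ENNReal.Tendsto.mul_const h1 (Or.inr hDfin)
  have := ge_of_tendsto hlim (eventually_nhdsWithin_of_forall (s := Ioi (0 : ℝ)) (a := 0)
    fun ε hε => hle ε hε)
  exact hLpos.not_ge this

/-! ### Bounds for the power weight and its measure -/

theorem measurable_powerWeight (α : ℝ) : Measurable (powerWeight α) :=
  (by fun_prop : Measurable fun x : ℝ => ENNReal.ofReal (x ^ α)).indicator measurableSet_Icc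

theorem powerWeight_le {α : ℝ} (hα : 0 ≤ α) {x b : ℝ} (hx : x ≤ b) :
    powerWeight α x ≤ ENNReal.ofReal (b ^ α) := by
  by_cases h : x ∈ Icc (0 : ℝ) 1
  · rw [powerWeight, indicator_of_mem h]
    exact ENNReal.ofReal_le_ofReal (Real.rpow_le_rpow h.1 hx hα)
  · simp [powerWeight, h]

theorem powerWeight_le_one {α : ℝ} (hα : 0 ≤ α) (x : ℝ) : powerWeight α x ≤ 1 := by
  by_cases h : x ∈ Icc (0 : ℝ) 1
  · simpa using powerWeight_le hα h.2
  · simp [powerWeight, h]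

theorem powerMeasure_le {α : ℝ} (hα : 0 ≤ α) {S : Set ℝ} {a b : ℝ} (hS : S ⊆ Icc a b) :
    powerMeasure α S ≤ ENNReal.ofReal ((b - a) * b ^ α) := by
  refine (measure_mono hS).trans ?_
  rw [powerMeasure, withDensity_apply _ measurableSet_Icc]
  rcases lt_or_ge b a with hab | hab
  · simp [hab.not_ge]
  refine (setLIntegral_mono' measurableSet_Icc fun x hx =>
    powerWeight_le hα hx.2).trans ?_
  rw [setLIntegral_const, Real.volume_Icc, mul_comm, ENNReal.ofReal_mul (by linarith)]

theorem le_powerMeasure {α : ℝ} (hα : 0 ≤ α) {a b : ℝ} (ha : 0 ≤ a) (hb : b ≤ 1) :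
    ENNReal.ofReal ((b - a) * a ^ α) ≤ powerMeasure α (Ioo a b) := by
  rw [powerMeasure, withDensity_apply _ measurableSet_Ioo]
  refine le_trans ?_ (setLIntegral_mono' (f := fun _ => ENNReal.ofReal (a ^ α))
    measurableSet_Ioo fun x hx => ?_)
  · rw [setLIntegral_const, Real.volume_Ioo, mul_comm, ENNReal.ofReal_mul (by positivity), mul_comm,
      mul_comm]
  · rw [powerWeight, indicator_of_mem (show x ∈ Icc (0 : ℝ) 1 from
      ⟨by linarith [hx.1], by linarith [hx.2]⟩)]
    exact ENNReal.ofReal_le_ofReal (Real.rpow_le_rpow ha hx.1.le hα)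

theorem powerMeasure_Ioo_pos {α : ℝ} (hα : 0 ≤ α) {a b : ℝ} (ha : 0 ≤ a) (hab : a < b)
    (hb : b ≤ 1) : 0 < powerMeasure α (Ioo a b) := by
  have h1 : 0 < ENNReal.ofReal ((b - (a + b) / 2) * ((a + b) / 2) ^ α) :=
    ENNReal.ofReal_pos.2 (mul_pos (by linarith) (Real.rpow_pos_of_pos (by linarith) _))
  exact h1.trans_le ((le_powerMeasure hα (by linarith) hb).trans
    (measure_mono (Ioo_subset_Ioo_left (by linarith))))

theorem powerMeasure_lt_top {α : ℝ} (hα : 0 ≤ α) (S : Set ℝ) : powerMeasure α S < ∞ := by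
  have h : powerMeasure α = (powerMeasure α).restrict (Icc 0 1) := by
    rw [powerMeasure, restrict_withDensity measurableSet_Icc, powerWeight,
      withDensity_indicator measurableSet_Icc, withDensity_indicator measurableSet_Icc,
      Measure.restrict_restrict measurableSet_Icc, inter_self]
  rw [h]
  refine (measure_mono (subset_univ S)).trans_lt ?_
  rw [Measure.restrict_apply_univ]
  exact (powerMeasure_le hα (a := 0) (b := 1) subset_rfl).trans_lt ENNReal.ofReal_lt_top

theorem lintegral_truncInv_rpow_lt_top {α p : ℝ} (hp : 1 ≤ p) (hpα : p < 1 + α) :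
    ∫⁻ s, truncInv 1 s ^ p ∂(powerMeasure α) < ∞ := by
  rw [powerMeasure, lintegral_withDensity_eq_lintegral_mul _ (measurable_powerWeight α)
    ((measurable_truncInv 1).pow_const p)]
  have h : (fun s => (powerWeight α * fun s => truncInv 1 s ^ p) s) =
      (Ioo (0 : ℝ) 1).indicator fun s => ENNReal.ofReal (s ^ (α - p)) := by
    ext s
    by_cases hs : s ∈ Ioo (0 : ℝ) 1
    · have hs0 : (0 : ℝ) < s := hs.1
      rw [Pi.mul_apply, powerWeight, truncInv, indicator_of_mem (Ioo_subset_Icc_self hs),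
        indicator_of_mem hs, indicator_of_mem hs, one_mul,
        ENNReal.ofReal_rpow_of_nonneg (by positivity) (by linarith),
        ← ENNReal.ofReal_mul (by positivity), Real.inv_rpow hs0.le, ← Real.rpow_neg hs0.le,
        ← Real.rpow_add hs0, sub_eq_add_neg]
    · have : (0 : ℝ) < p := by linarith
      simp [truncInv, hs, this]
  rw [h, lintegral_indicator measurableSet_Ioo]
  have hi := (intervalIntegral.integrableOn_Ioo_rpow_iff (s := α - p) one_pos).2 (by linarith)
  refine lt_of_le_of_lt (setLIntegral_mono' measurableSet_Ioo fun s _ => ?_) hi.2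
  rw [← ofReal_norm]
  exact ENNReal.ofReal_le_ofReal (le_abs_self _)

/-! ### Failure of the `A_p` condition -/

/-- On the whole interval `(0, 1)` the right-hand side is zero: for `p = 1` since `x ^ α → 0` at the
origin, and for `p > 1` since `α / (1 - p) ≤ -1` makes the dual integral infinite, with `∞ ^ (1 - p)
= 0`. -/
theorem not_isApWeightWithin_powerWeight {α p : ℝ} (hp : 1 ≤ p) (hpα : p < 1 + α) :
    ¬ IsApWeightWithin (powerWeight α) p (1 / 2) (1 / 2) := by
  rintro ⟨C, hC, h⟩
  have hα : 0 < α := by linarith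
  refine absurd (h (1 / 2) (1 / 2) (by norm_num) subset_rfl) (not_lt.2 ?_)
  have hball : ball (1 / 2 : ℝ) (1 / 2) = Ioo 0 1 := by rw [Real.ball_eq_Ioo]; norm_num
  rw [hball]
  split_ifs with hp1
  · have : essInf (powerWeight α) (volume.restrict (Ioo (0 : ℝ) 1)) = 0 := by
      by_contra hne
      obtain ⟨c, hc0, hc⟩ := exists_between (pos_iff_ne_zero.2 hne)
      have hae := ae_lt_of_lt_essInf (μ := volume.restrict (Ioo (0 : ℝ) 1)) (f := powerWeight α) hc
      have hcont : Filter.Tendsto (fun x : ℝ => ENNReal.ofReal (x ^ α)) (nhds 0) (nhds 0) := by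
        have := ((Real.continuous_rpow_const hα.le).tendsto 0)
        rw [Real.zero_rpow hα.ne'] at this
        simpa [Function.comp_def] using (ENNReal.continuous_ofReal.tendsto 0).comp this
      obtain ⟨δ, hδ, hball'⟩ := Metric.eventually_nhds_iff_ball.1
        (hcont.eventually (gt_mem_nhds hc0))
      rw [ae_iff, Measure.restrict_apply₀' measurableSet_Ioo.nullMeasurableSet] at hae
      have hsub : Ioo 0 (min δ 1) ⊆ {a | ¬c < powerWeight α a} ∩ Ioo 0 1 := by
        intro x hx
        have hx1 : x < 1 := hx.2.trans_le (min_le_right _ _)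
        have hxδ : x < δ := hx.2.trans_le (min_le_left _ _)
        refine ⟨?_, hx.1, hx1⟩
        rw [mem_ofPred_eq, powerWeight, indicator_of_mem (show x ∈ Icc (0 : ℝ) 1 from
          ⟨hx.1.le, hx1.le⟩), not_lt]
        refine (hball' x ?_).le
        rw [mem_ball, Real.dist_eq, sub_zero, abs_of_pos hx.1]
        exact hxδ
      have := measure_mono_null hsub hae
      rw [Real.volume_Ioo, ENNReal.ofReal_eq_zero] at this
      have : 0 < min δ 1 := lt_min hδ one_pos
      linarith
    simp [this]
  · have hp' : 1 < p := lt_of_le_of_ne hp (Ne.symm hp1)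
    have htop : ∫⁻ y in Ioo (0 : ℝ) 1, powerWeight α y ^ (1 / (1 - p)) = ∞ := by
      by_contra hne
      have hexp : α * (1 / (1 - p)) ≤ -1 := by
        rw [mul_one_div, div_le_iff_of_neg (by linarith)]
        linarith
      refine absurd ((intervalIntegral.integrableOn_Ioo_rpow_iff
        (s := α * (1 / (1 - p))) one_pos).1 ?_) (not_lt.2 hexp)
      refine ⟨Measurable.aestronglyMeasurable (by fun_prop), lt_of_le_of_lt ?_
        (lt_top_iff_ne_top.2 hne)⟩
      refine setLIntegral_mono' measurableSet_Ioo fun y hy => ?_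
      have hy0 : (0 : ℝ) < y := hy.1
      rw [powerWeight, indicator_of_mem (Ioo_subset_Icc_self hy),
        ENNReal.ofReal_rpow_of_pos (by positivity), ← Real.rpow_mul hy0.le, ← ofReal_norm,
        Real.norm_of_nonneg (by positivity)]
    rw [setLAverage_eq, htop]
    have hneg : 1 - p < 0 := by linarith
    simp [hneg]

/-! ### Failure of the Poincaré inequality for extensions and reflections -/

theorem not_poincareOnBall_of_restrict_eq {α p : ℝ} (hα : 0 ≤ α) (hp : 1 ≤ p) (hpα : p < 1 + α)
    {ν : Measure ℝ} (hν : ν.restrict (Icc 0 1) = powerMeasure α) {C lam r : ℝ}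
    (hlam : 1 ≤ lam) (hr : 0 < r) (hfin : ν (ball 0 (lam * r)) < ∞)
    (hneg : 0 < ν (Ioc (-r) 0)) : ¬ PoincareOnBall ν p C lam 0 r := by
  refine not_poincareOnBall_of_lintegral_truncInv (h := id) measurable_id hp hlam hr
    LipschitzWith.id.lipschitzOnWith hfin ?_ ?_ ?_
  · refine (powerMeasure_Ioo_pos hα le_rfl (lt_min hr one_pos) (min_le_right _ _)).trans_le ?_
    rw [← hν]
    refine (Measure.restrict_apply_le _ _).trans (measure_mono fun x hx => ⟨?_, hx.1⟩)
    rw [mem_ball, Real.dist_eq, sub_zero, abs_of_pos hx.1]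
    exact hx.2.trans_le (min_le_left _ _)
  · refine hneg.trans_le (measure_mono fun x hx => ⟨?_, hx.2⟩)
    rw [mem_ball, Real.dist_eq, sub_zero, abs_of_nonpos hx.2]
    linarith [hx.1]
  · refine (setLIntegral_le_lintegral _ _).trans_lt ?_
    have : (fun y : ℝ => truncInv 1 (id y) ^ p) =
        (Icc (0 : ℝ) 1).indicator fun y => truncInv 1 y ^ p := by
      ext y
      by_cases hy : y ∈ Icc (0 : ℝ) 1
      · simp [hy]
      · have h1 : y ∉ Ioo (0 : ℝ) 1 := fun h => hy (Ioo_subset_Icc_self h)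
        have : (0 : ℝ) < p := by linarith
        simp [hy, truncInv, h1, this]
    rw [this, lintegral_indicator measurableSet_Icc, hν]
    exact lintegral_truncInv_rpow_lt_top hp hpα

theorem not_poincareOnBall_of_posFiniteOnBalls {α p : ℝ} (hα : 0 ≤ α) (hp : 1 ≤ p)
    (hpα : p < 1 + α) {ν : Measure ℝ} (hb : PosFiniteOnBalls ν)
    (hν : ν.restrict (Icc 0 1) = powerMeasure α) {C lam r : ℝ}
    (hlam : 1 ≤ lam) (hr : 0 < r) : ¬ PoincareOnBall ν p C lam 0 r := by
  refine not_poincareOnBall_of_restrict_eq hα hp hpα hν hlam hr (hb 0 _ (by positivity)).2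
    ((hb (-(r / 2)) (r / 2) (by positivity)).1.trans_le (measure_mono fun x hx => ?_))
  rw [Real.ball_eq_Ioo] at hx
  exact ⟨by linarith [hx.1], by linarith [hx.2]⟩

theorem periodicReflection_one_of_nonneg (w : ℝ → ℝ≥0∞) {x : ℝ} (h0 : 0 ≤ x) (h1 : x ≤ 1) :
    periodicReflection w 1 x = w x := by
  have : ⌊x / (2 * 1)⌋ = 0 := Int.floor_eq_iff.2 ⟨by norm_num; linarith, by norm_num; linarith⟩
  rw [periodicReflection, this]
  simp [h1]

theorem periodicReflection_one_of_neg (w : ℝ → ℝ≥0∞) {x : ℝ} (h0 : -1 < x) (h1 : x < 0) :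
    periodicReflection w 1 x = w (-x) := by
  have : ⌊x / (2 * 1)⌋ = -1 := Int.floor_eq_iff.2 ⟨by norm_num; linarith, by norm_num; linarith⟩
  rw [periodicReflection, this, if_neg (by push_cast; linarith)]
  congr 1
  push_cast
  ring

theorem not_supportsPoincare_periodicReflection {α p : ℝ} (hα : 0 ≤ α) (hp : 1 ≤ p)
    (hpα : p < 1 + α) :
    ¬ SupportsPoincare (volume.withDensity (periodicReflection (powerWeight α) 1)) p := by
  rintro ⟨C, lam, hC, hlam, h⟩
  refine not_poincareOnBall_of_restrict_eq hα hp hpα ?_ hlam one_pos ?_ ?_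
    (h 0 1 one_pos 0 1 one_pos subset_rfl)
  · rw [restrict_withDensity measurableSet_Icc, powerMeasure, powerWeight,
      withDensity_indicator measurableSet_Icc]
    refine withDensity_congr_ae ((ae_restrict_iff' measurableSet_Icc).2
      (Filter.Eventually.of_forall fun x hx => ?_))
    rw [periodicReflection_one_of_nonneg _ hx.1 hx.2, indicator_of_mem hx]
  · rw [withDensity_apply _ measurableSet_ball]
    refine (setLIntegral_mono' measurableSet_ball (g := fun _ => 1) fun x _ => ?_).trans_lt ?_
    · unfold periodicReflection
      split_ifs <;> exact powerWeight_le_one hα _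
    · simp [ENNReal.mul_lt_top]
  · have hsub : Ioo (-1 : ℝ) (-(1 / 2)) ⊆ Ioc (-1) 0 := fun x hx => ⟨hx.1, by linarith [hx.2]⟩
    refine lt_of_lt_of_le ?_ (measure_mono hsub)
    rw [withDensity_apply _ measurableSet_Ioo]
    refine lt_of_lt_of_le ?_ (setLIntegral_mono' measurableSet_Ioo
      (f := fun _ => ENNReal.ofReal ((1 / 2) ^ α)) fun x hx => ?_)
    · rw [setLIntegral_const, Real.volume_Ioo]
      refine ENNReal.mul_pos ?_ ?_
      · simpa using Real.rpow_pos_of_pos (by norm_num) α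
      · norm_num
    · rw [periodicReflection_one_of_neg _ hx.1 (by linarith [hx.2]), powerWeight,
        indicator_of_mem (show -x ∈ Icc (0 : ℝ) 1 from ⟨by linarith [hx.2], by linarith [hx.1]⟩)]
      exact ENNReal.ofReal_le_ofReal
        (Real.rpow_le_rpow (by norm_num) (by linarith [hx.2]) hα)

theorem not_supportsPoincare_circleReflection {α p : ℝ} (hα : 0 ≤ α) (hp : 1 ≤ p)
    (hpα : p < 1 + α) : ¬ SupportsPoincare (circleReflection (powerMeasure α) 1) p := by
  rintro ⟨C, lam, hC, hlam, hP⟩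
  have : Fact (0 < 2 * (1 : ℝ)) := ⟨by norm_num⟩
  set μ := (powerMeasure α).restrict (Icc 0 1) with hμ
  have hcm : Measurable fun x : ℝ => (x : AddCircle (2 * (1 : ℝ))) := AddCircle.measurable_mk'
  have hnm : Measurable fun x : ℝ => -x := measurable_neg
  -- `h` is the coordinate in `(-1, 1]`. It jumps at the point `±1`, so it is 1-Lipschitz only
  -- locally; the radius `1 / (2 * lam)` is chosen below so that the dilated ball has radius `1 /
  -- 2`, where arc length equals the difference of coordinates.
  set h : AddCircle (2 * (1 : ℝ)) → ℝ := fun y => AddCircle.equivIoc (2 * (1 : ℝ)) (-1) y with hh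
  have hm : Measurable h :=
    measurable_subtype_coe.comp (AddCircle.measurableEquivIoc (2 * (1 : ℝ)) (-1)).measurable
  have hcoe : ∀ y, ((h y : ℝ) : AddCircle (2 * (1 : ℝ))) = y := fun y => AddCircle.coe_equivIoc
  have hmem : ∀ y, h y ∈ Ioc (-1 : ℝ) 1 := fun y => by
    have := (AddCircle.equivIoc (2 * (1 : ℝ)) (-1) y).2
    norm_num at this
    exact this
  have hof : ∀ x ∈ Ioc (-1 : ℝ) 1, h (x : AddCircle (2 * (1 : ℝ))) = x := fun x hx =>
    AddCircle.equivIoc_coe_of_mem (by norm_num; exact hx)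
  have hnorm : ∀ x : ℝ, |x| ≤ 1 → ‖(x : AddCircle (2 * (1 : ℝ)))‖ = |x| := fun x hx =>
    (AddCircle.norm_coe_eq_abs_iff _ (by norm_num)).2 (by norm_num; exact hx)
  have hlip : LipschitzOnWith 1 h (ball 0 (1 / 2)) := by
    refine LipschitzOnWith.of_dist_le_mul fun x hx y hy => ?_
    have key : ∀ z ∈ ball (0 : AddCircle (2 * (1 : ℝ))) (1 / 2), |h z| < 1 / 2 := fun z hz => by
      rw [mem_ball, dist_zero_right, ← hcoe z,
        hnorm _ (abs_le.2 ⟨(hmem z).1.le, (hmem z).2⟩)] at hz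
      exact hz
    have h1 := abs_lt.1 (key x hx)
    have h2 := abs_lt.1 (key y hy)
    rw [NNReal.coe_one, one_mul, Real.dist_eq, dist_eq_norm, ← hnorm, AddCircle.coe_sub, hcoe, hcoe]
    rw [abs_le]; constructor <;> linarith
  have hr : 0 < 1 / (2 * lam) := by positivity
  have hlr : lam * (1 / (2 * lam)) = 1 / 2 := by field_simp
  have hρ : 0 < min (1 / (2 * lam)) 1 := lt_min hr one_pos
  have hball : ∀ x : ℝ, |x| < min (1 / (2 * lam)) 1 →
      (x : AddCircle (2 * (1 : ℝ))) ∈ ball 0 (1 / (2 * lam)) := fun x hx => by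
    rw [mem_ball, dist_zero_right, hnorm x (hx.le.trans (min_le_right _ _))]
    exact hx.trans_le (min_le_left _ _)
  have hpos : 0 < μ (Ioo 0 (min (1 / (2 * lam)) 1)) := by
    rw [hμ, Measure.restrict_apply measurableSet_Ioo, inter_eq_left.2]
    · exact powerMeasure_Ioo_pos hα le_rfl hρ (min_le_right _ _)
    · exact fun x hx => ⟨hx.1.le, hx.2.le.trans (min_le_right _ _)⟩
  have happ : ∀ E : Set (AddCircle (2 * (1 : ℝ))), MeasurableSet E →
      circleReflection (powerMeasure α) 1 E =
        μ ((fun x : ℝ => (x : AddCircle (2 * (1 : ℝ)))) ⁻¹' E) +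
          μ ((fun x : ℝ => ((-x : ℝ) : AddCircle (2 * (1 : ℝ)))) ⁻¹' E) := fun E hE => by
    rw [circleReflection, Measure.map_apply hcm hE, Measure.add_apply,
      Measure.map_apply hnm (hcm hE)]
    rfl
  refine not_poincareOnBall_of_lintegral_truncInv hm hp hlam hr (by rwa [hlr]) ?_ ?_ ?_ ?_
    (hP 0 _ hr 0 _ hr subset_rfl)
  · rw [happ _ measurableSet_ball]
    exact ENNReal.add_lt_top.2 ⟨(Measure.restrict_apply_le _ _).trans_lt (powerMeasure_lt_top hα _),
      (Measure.restrict_apply_le _ _).trans_lt (powerMeasure_lt_top hα _)⟩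
  · rw [happ _ (measurableSet_ball.inter (measurableSet_lt measurable_const hm))]
    refine hpos.trans_le (le_trans (measure_mono fun x hx => ?_) le_self_add)
    refine ⟨hball x (by rw [abs_of_pos hx.1]; exact hx.2), ?_⟩
    rw [mem_ofPred_eq, hof x ⟨by linarith [hx.1], hx.2.le.trans (min_le_right _ _)⟩]
    exact hx.1
  · rw [happ _ (measurableSet_ball.inter (measurableSet_le hm measurable_const))]
    refine hpos.trans_le (le_trans (measure_mono fun x hx => ?_) le_add_self)
    have hx1 : x < 1 := hx.2.trans_le (min_le_right _ _)
    refine ⟨hball (-x) (by rw [abs_neg, abs_of_pos hx.1]; exact hx.2), ?_⟩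
    rw [mem_ofPred_eq, hof (-x) ⟨by linarith, by linarith [hx.1]⟩]
    linarith [hx.1]
  · refine (setLIntegral_le_lintegral _ _).trans_lt ?_
    have hF : Measurable fun y => truncInv 1 (h y) ^ p :=
      ((measurable_truncInv 1).comp hm).pow_const p
    rw [circleReflection, lintegral_map hF hcm, lintegral_add_measure,
      lintegral_map (f := fun a : ℝ => truncInv 1 (h (a : AddCircle (2 * (1 : ℝ)))) ^ p)
        (hF.comp hcm) hnm, ENNReal.add_lt_top]
    constructor
    · refine lt_of_le_of_lt ?_ (lintegral_truncInv_rpow_lt_top hp hpα)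
      refine (setLIntegral_mono' measurableSet_Icc fun x hx => ?_).trans
        (setLIntegral_le_lintegral _ _)
      rw [hof x ⟨by linarith [hx.1], hx.2⟩]
    · refine lt_of_le_of_lt (setLIntegral_mono' measurableSet_Icc (g := fun _ => 0)
        fun x hx => ?_) (by simp)
      have hnot : h ((-x : ℝ) : AddCircle (2 * (1 : ℝ))) ∉ Ioo (0 : ℝ) 1 := by
        -- The reflected endpoint `-1` is the same point as `1`, so its coordinate is positive;
        -- `truncInv` still vanishes there because `(0, 1)` excludes 1.
        rcases eq_or_lt_of_le hx.2 with hx1 | hx1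
        · have : ((-x : ℝ) : AddCircle (2 * (1 : ℝ))) = ((1 : ℝ) : AddCircle (2 * (1 : ℝ))) := by
            rw [hx1, ← sub_eq_zero, ← AddCircle.coe_sub, AddCircle.coe_eq_zero_iff]
            exact ⟨-1, by norm_num⟩
          rw [this, hof 1 (by norm_num)]
          simp
        · rw [hof (-x) ⟨by linarith, by linarith [hx.1]⟩]
          exact fun hx' => by linarith [hx'.1, hx.1]
      rw [truncInv, indicator_of_notMem hnot, ENNReal.zero_rpow_of_pos (by linarith)]

/-! ### Reduction of the 1-Poincaré inequality to a two-point estimate -/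

theorem lintegral_enorm_sub_integral_le {X : Type*} [MeasurableSpace X] {κ : Measure X}
    [IsProbabilityMeasure κ] {f : X → ℝ} (hf : Integrable f κ) :
    ∫⁻ x, ‖f x - ∫ y, f y ∂κ‖ₑ ∂κ ≤ ∫⁻ x, ∫⁻ y, ‖f x - f y‖ₑ ∂κ ∂κ := by
  refine lintegral_mono fun x => ?_
  have : f x - ∫ y, f y ∂κ = ∫ y, (f x - f y) ∂κ := by
    rw [integral_sub (integrable_const _) hf]
    simp
  rw [this]
  exact enorm_integral_le_lintegral_enorm _

/-- By Tonelli, `G t` is counted once for each pair separated by `t`. With half-open intervals these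
pairs form exactly the product of `{φ < t}` and `{φ ≥ t}` and its transpose, hence the factor 2. -/
theorem lintegral_lintegral_le_of_le_lintegral_uIoc {X : Type*} [MeasurableSpace X] {κ : Measure X}
    [SFinite κ] {φ : X → ℝ} (hφ : Measurable φ) {G : ℝ → ℝ≥0∞} (hG : Measurable G)
    {k : X → X → ℝ≥0∞} (h : ∀ᵐ x ∂κ, ∀ᵐ y ∂κ, k x y ≤ ∫⁻ t in uIoc (φ x) (φ y), G t) :
    ∫⁻ x, ∫⁻ y, k x y ∂κ ∂κ ≤
      ∫⁻ t, G t * (2 * (κ (φ ⁻¹' Iio t) * κ (φ ⁻¹' Ici t))) := by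
  set A : Set ((X × X) × ℝ) := {q | φ q.1.1 < q.2 ∧ q.2 ≤ φ q.1.2} with hA
  set B : Set ((X × X) × ℝ) := {q | φ q.1.2 < q.2 ∧ q.2 ≤ φ q.1.1} with hB
  have h1 : Measurable fun q : (X × X) × ℝ => φ q.1.1 := by fun_prop
  have h2 : Measurable fun q : (X × X) × ℝ => φ q.1.2 := by fun_prop
  have hAm : MeasurableSet A :=
    (measurableSet_lt h1 measurable_snd).inter (measurableSet_le measurable_snd h2)
  have hBm : MeasurableSet B :=
    (measurableSet_lt h2 measurable_snd).inter (measurableSet_le measurable_snd h1)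
  set F : (X × X) × ℝ → ℝ≥0∞ := fun q => G q.2 * (A.indicator 1 q + B.indicator 1 q) with hF
  have hFm : Measurable F := by
    have := hG.comp (measurable_snd : Measurable fun q : (X × X) × ℝ => q.2)
    exact this.mul ((measurable_one.indicator hAm).add (measurable_one.indicator hBm))
  have hu : ∀ x y, ∫⁻ t in uIoc (φ x) (φ y), G t ≤ ∫⁻ t, F ((x, y), t) := fun x y => by
    rw [← lintegral_indicator measurableSet_uIoc]
    refine lintegral_mono fun t => ?_
    by_cases ht : t ∈ uIoc (φ x) (φ y)
    · rw [indicator_of_mem ht, hF]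
      refine le_mul_of_one_le_right' ?_
      rcases mem_uIoc.1 ht with ht | ht
      · have : ((x, y), t) ∈ A := ht
        simp [this]
      · have : ((x, y), t) ∈ B := ht
        simp [this]
    · simp [ht]
  calc ∫⁻ x, ∫⁻ y, k x y ∂κ ∂κ ≤ ∫⁻ x, ∫⁻ y, (∫⁻ t, F ((x, y), t)) ∂κ ∂κ := by
        refine lintegral_mono_ae (h.mono fun x hx => ?_)
        exact lintegral_mono_ae (hx.mono fun y hy => hy.trans (hu x y))
    _ = ∫⁻ z, (∫⁻ t, F (z, t)) ∂(κ.prod κ) := by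
        rw [lintegral_prod _ hFm.lintegral_prod_right'.aemeasurable]
    _ = ∫⁻ t, ∫⁻ z, F (z, t) ∂(κ.prod κ) := lintegral_lintegral_swap hFm.aemeasurable
    _ = _ := by
        refine lintegral_congr fun t => ?_
        have hA' : ∀ z, A.indicator (1 : (X × X) × ℝ → ℝ≥0∞) (z, t) =
            ((φ ⁻¹' Iio t) ×ˢ (φ ⁻¹' Ici t)).indicator 1 z := fun z => rfl
        have hB' : ∀ z, B.indicator (1 : (X × X) × ℝ → ℝ≥0∞) (z, t) =
            ((φ ⁻¹' Ici t) ×ˢ (φ ⁻¹' Iio t)).indicator 1 z := fun z => by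
          simp only [indicator, hB, mem_ofPred_eq, mem_prod, mem_preimage, mem_Ici, mem_Iio,
            and_comm, Pi.one_apply]
        have hlo : MeasurableSet (φ ⁻¹' Iio t) := hφ measurableSet_Iio
        have hhi : MeasurableSet (φ ⁻¹' Ici t) := hφ measurableSet_Ici
        have hm1 : Measurable (((φ ⁻¹' Iio t) ×ˢ (φ ⁻¹' Ici t)).indicator
            (1 : X × X → ℝ≥0∞)) := measurable_one.indicator (hlo.prod hhi)
        have hm2 : Measurable (((φ ⁻¹' Ici t) ×ˢ (φ ⁻¹' Iio t)).indicator
            (1 : X × X → ℝ≥0∞)) := measurable_one.indicator (hhi.prod hlo)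
        simp only [hF, hA', hB']
        have hmul : ∀ c : ℝ≥0∞, ∫⁻ z, c * (((φ ⁻¹' Iio t) ×ˢ (φ ⁻¹' Ici t)).indicator 1 z +
            ((φ ⁻¹' Ici t) ×ˢ (φ ⁻¹' Iio t)).indicator 1 z) ∂(κ.prod κ) = c *
            ∫⁻ z, (((φ ⁻¹' Iio t) ×ˢ (φ ⁻¹' Ici t)).indicator 1 z +
            ((φ ⁻¹' Ici t) ×ˢ (φ ⁻¹' Iio t)).indicator 1 z) ∂(κ.prod κ) :=
          fun c => lintegral_const_mul c (hm1.add hm2)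
        rw [hmul, lintegral_add_left hm1,
          lintegral_indicator_one (hlo.prod hhi), lintegral_indicator_one (hhi.prod hlo),
          Measure.prod_prod, Measure.prod_prod, mul_comm (κ (φ ⁻¹' Ici t)), two_mul]

/-! ### The weight inequality behind the constant 2 -/

/-- The two factors are at most `exp (α x)` and `exp (-α x)`. -/
theorem one_add_rpow_mul_one_sub_le {α x : ℝ} (hα : 0 ≤ α) (hx : 0 ≤ x) :
    (1 + x) ^ α * (1 - (α + 1) * x) ≤ 1 := by
  have h1 : (1 + x) ^ α ≤ Real.exp (α * x) := by
    rw [mul_comm, Real.exp_mul]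
    exact Real.rpow_le_rpow (by linarith) (by linarith [Real.add_one_le_exp x]) hα
  have h2 : 1 - (α + 1) * x ≤ Real.exp (-(α * x)) := by
    have := Real.add_one_le_exp (-(α * x))
    nlinarith
  calc (1 + x) ^ α * (1 - (α + 1) * x) ≤ (1 + x) ^ α * Real.exp (-(α * x)) := by gcongr
    _ ≤ Real.exp (α * x) * Real.exp (-(α * x)) := by gcongr
    _ = 1 := by rw [← Real.exp_add]; simp

theorem add_rpow_mul_sub_le {α t q : ℝ} (hα : 0 ≤ α) (ht : 0 < t) (hq : 0 ≤ q) :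
    (t + q) ^ α * (t - (α + 1) * q) ≤ t ^ α * t := by
  have h := one_add_rpow_mul_one_sub_le hα (div_nonneg hq ht.le)
  have h1 : (t + q) ^ α = t ^ α * (1 + q / t) ^ α := by
    rw [← Real.mul_rpow ht.le (by positivity)]
    congr 1
    field_simp
  have h2 : t - (α + 1) * q = t * (1 - (α + 1) * (q / t)) := by field_simp
  rw [h1, h2]
  calc t ^ α * (1 + q / t) ^ α * (t * (1 - (α + 1) * (q / t)))
      = t ^ α * t * ((1 + q / t) ^ α * (1 - (α + 1) * (q / t))) := by ring
    _ ≤ t ^ α * t * 1 := by gcongr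
    _ = _ := mul_one _

/-- Here `M₁` and `M₂` stand for the masses left and right of `t`. The product is controlled through
the distance from `t` to the nearer endpoint, which is at most `(b - a) / 2`. Near `a` the bound on
`M₁` suffices because the weight increases; near `b` the mass `M₂` may exceed `(b - t) * t ^ α`, and
the total-mass bound `h4` compensates. -/
theorem two_mul_mul_le_of_rpow_bounds {α a b t M₁ M₂ : ℝ} (hα : 0 ≤ α) (ha : 0 ≤ a) (hat : a ≤ t)
    (htb : t ≤ b) (h1 : 0 ≤ M₁) (h2 : 0 ≤ M₂) (h3 : M₁ ≤ (t - a) * t ^ α)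
    (h4 : (α + 1) * M₁ ≤ t ^ α * t) (h5 : M₂ ≤ (b - t) * b ^ α) :
    2 * (M₁ * M₂) ≤ (b - a) * t ^ α * (M₁ + M₂) := by
  rcases (ha.trans hat).eq_or_lt with ht | ht
  · have : M₁ = 0 := by
      rw [← ht] at hat h3
      have : a = 0 := le_antisymm hat ha
      simp only [this, sub_self, zero_mul] at h3
      exact le_antisymm h3 h1
    rw [this]
    have : 0 ≤ t ^ α := Real.rpow_nonneg (ha.trans hat) _
    have : 0 ≤ b - a := by linarith
    simp only [zero_mul, mul_zero]
    positivity
  set w := t ^ α with hw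
  have hw0 : 0 < w := Real.rpow_pos_of_pos ht _
  rcases le_total (t - a) (b - t) with hc | hc
  · have : M₁ * M₂ ≤ (t - a) * w * (M₁ + M₂) := by
      have h6 : 0 ≤ (t - a) * w := mul_nonneg (by linarith) hw0.le
      nlinarith
    have : (t - a) * w * (M₁ + M₂) * 2 ≤ (b - a) * w * (M₁ + M₂) := by
      have : 2 * (t - a) ≤ b - a := by linarith
      have : 0 ≤ w * (M₁ + M₂) := by positivity
      nlinarith
    linarith
  · set q := b - t with hq
    have hq0 : 0 ≤ q := by linarith
    have hb : b = t + q := by simp [hq]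
    have key : M₁ * M₂ ≤ q * w * (M₁ + M₂) := by
      rcases le_total M₁ (q * w) with hM | hM
      · nlinarith [mul_nonneg h2 (sub_nonneg.2 hM), mul_nonneg (mul_nonneg hq0 hw0.le) h1]
      · have h6 := add_rpow_mul_sub_le hα ht hq0
        rw [← hb, ← hw] at h6
        have h7 : M₂ * (M₁ - q * w) ≤ q * b ^ α * (M₁ - q * w) :=
          mul_le_mul_of_nonneg_right h5 (by linarith)
        -- Equivalent to `(b ^ α - w) * M₁ ≤ b ^ α * (q * w)`. Replacing `M₁` by its bound from `h4`
        -- turns this into `add_rpow_mul_sub_le`.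
        have h8 : b ^ α * (M₁ - q * w) ≤ w * M₁ := by
          have hwb : w ≤ b ^ α := Real.rpow_le_rpow ht.le htb hα
          have h9 : 0 < α + 1 := by linarith
          have h10 : (α + 1) * ((b ^ α - w) * M₁) ≤ (b ^ α - w) * (w * t) := by
            nlinarith [mul_le_mul_of_nonneg_left h4 (sub_nonneg.2 hwb)]
          have h11 : (b ^ α - w) * (w * t) ≤ (α + 1) * (b ^ α * (q * w)) := by
            nlinarith [mul_le_mul_of_nonneg_left h6 hw0.le]
          have h12 : (b ^ α - w) * M₁ ≤ b ^ α * (q * w) :=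
            le_of_mul_le_mul_left (h10.trans h11) h9
          linarith
        nlinarith [mul_le_mul_of_nonneg_left h8 hq0]
    have : q * w * (M₁ + M₂) * 2 ≤ (b - a) * w * (M₁ + M₂) := by
      have : 2 * q ≤ b - a := by linarith
      have : 0 ≤ w * (M₁ + M₂) := by positivity
      nlinarith
    linarith

theorem powerMeasure_Icc_zero_le {α t : ℝ} (hα : 0 ≤ α) (ht : 0 ≤ t) :
    powerMeasure α (Icc 0 t) ≤ ENNReal.ofReal (t ^ (α + 1) / (α + 1)) := by
  have h : ∫⁻ x in Icc 0 t, ENNReal.ofReal (x ^ α) = ENNReal.ofReal (t ^ (α + 1) / (α + 1)) := by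
    rw [← ofReal_integral_eq_lintegral_ofReal]
    · rw [integral_Icc_eq_integral_Ioc, ← intervalIntegral.integral_of_le ht,
        integral_rpow (Or.inl (by linarith)), Real.zero_rpow (by linarith), sub_zero]
    · exact (Real.continuous_rpow_const hα).continuousOn.integrableOn_Icc
    · exact (ae_restrict_iff' measurableSet_Icc).2
        (Filter.Eventually.of_forall fun x hx => Real.rpow_nonneg hx.1 _)
  rw [← h, powerMeasure, withDensity_apply _ measurableSet_Icc]
  exact lintegral_mono fun x => indicator_le_self _ _ _

theorem two_mul_powerMeasure_mul_le {α : ℝ} (hα : 0 ≤ α) {S : Set ℝ} {a b t : ℝ} (ha : 0 ≤ a)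
    (hb : b ≤ 1) (hS : S ⊆ Icc a b) (ht : t ∈ Icc a b) :
    2 * (powerMeasure α (S ∩ Iio t) * powerMeasure α (S ∩ Ici t)) ≤
      ENNReal.ofReal (b - a) * powerWeight α t * powerMeasure α S := by
  have hf : ∀ E, powerMeasure α E ≠ ∞ := fun E => (powerMeasure_lt_top hα E).ne
  have ht0 : 0 ≤ t := ha.trans ht.1
  have hsplit : powerMeasure α S = powerMeasure α (S ∩ Iio t) + powerMeasure α (S ∩ Ici t) := by
    rw [← measure_inter_add_sdiff S (measurableSet_Iio (a := t)), sdiff_eq, compl_Iio]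
  have e1 : powerMeasure α (S ∩ Iio t) ≤ ENNReal.ofReal ((t - a) * t ^ α) :=
    powerMeasure_le hα fun x hx => ⟨(hS hx.1).1, hx.2.le⟩
  have e2 : powerMeasure α (S ∩ Iio t) ≤ ENNReal.ofReal (t ^ (α + 1) / (α + 1)) :=
    (measure_mono (t := Icc 0 t) fun x hx => ⟨ha.trans (hS hx.1).1, hx.2.le⟩).trans
      (powerMeasure_Icc_zero_le hα ht0)
  have e3 : powerMeasure α (S ∩ Ici t) ≤ ENNReal.ofReal ((b - t) * b ^ α) :=
    powerMeasure_le hα fun x hx => ⟨hx.2, (hS hx.1).2⟩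
  have hwt : 0 ≤ t ^ α := Real.rpow_nonneg ht0 _
  rw [hsplit, powerWeight, indicator_of_mem (show t ∈ Icc (0 : ℝ) 1 from ⟨ht0, ht.2.trans hb⟩)]
  set m₁ := powerMeasure α (S ∩ Iio t)
  set m₂ := powerMeasure α (S ∩ Ici t)
  have hm1 : m₁ = ENNReal.ofReal m₁.toReal := (ENNReal.ofReal_toReal (hf _)).symm
  have hm2 : m₂ = ENNReal.ofReal m₂.toReal := (ENNReal.ofReal_toReal (hf _)).symm
  have f1 := ENNReal.toReal_le_of_le_ofReal
    (mul_nonneg (by linarith [ht.1]) hwt) e1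
  have f2 := ENNReal.toReal_le_of_le_ofReal
    (div_nonneg (Real.rpow_nonneg ht0 _) (by linarith)) e2
  have f3 := ENNReal.toReal_le_of_le_ofReal
    (mul_nonneg (by linarith [ht.2]) (Real.rpow_nonneg (ht0.trans ht.2) _)) e3
  have f2' : (α + 1) * m₁.toReal ≤ t ^ α * t := by
    rw [le_div_iff₀ (by linarith), Real.rpow_add_one' ht0 (by linarith)] at f2
    linarith
  have key := two_mul_mul_le_of_rpow_bounds hα ha ht.1 ht.2 ENNReal.toReal_nonneg
    ENNReal.toReal_nonneg f1 f2' f3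
  rw [hm1, hm2, ← ENNReal.ofReal_mul ENNReal.toReal_nonneg,
    ← ENNReal.ofReal_add ENNReal.toReal_nonneg ENNReal.toReal_nonneg,
    ← ENNReal.ofReal_mul (by linarith [ht.1, ht.2]),
    ← ENNReal.ofReal_mul (mul_nonneg (by linarith [ht.1, ht.2]) hwt),
    show (2 : ℝ≥0∞) = ENNReal.ofReal 2 by simp, ← ENNReal.ofReal_mul (by norm_num)]
  exact ENNReal.ofReal_le_ofReal key

/-! ### The Poincaré inequality on isometric copies of intervals -/

theorem hasUnitSpeedOn_of_edist_eq {X : Type*} [PseudoEMetricSpace X] {γ : ℝ → X} {s : Set ℝ}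
    (h : ∀ x ∈ s, ∀ y ∈ s, edist (γ x) (γ y) = edist x y) : HasUnitSpeedOn γ s := by
  intro x hx y hy
  have h1 : eVariationOn γ (s ∩ Icc x y) = eVariationOn (id : ℝ → ℝ) (s ∩ Icc x y) := by
    unfold eVariationOn
    refine iSup_congr fun q => Finset.sum_congr rfl fun i _ => ?_
    exact h _ (q.2.2.2 _).1 _ (q.2.2.2 _).1
  rw [h1, monotoneOn_id.eVariationOn_eq hx hy]
  simp

/-- Order-connectedness of the image lets the segment from `φ x` to `φ y` be pulled back by the
inverse of `φ` to an arc-length curve inside `B`. -/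
theorem abs_sub_le_lintegral_Ioc_of_isometry {X : Type*} [MetricSpace X] [MeasurableSpace X]
    {φ : X → ℝ} (hφ : Isometry φ) {B : Set X} (hconn : OrdConnected (φ '' B)) {u : X → EReal}
    {g : X → ℝ≥0∞} (hg : IsUpperGradientOn g u B) {G : ℝ → ℝ≥0∞} (hG : ∀ y ∈ B, G (φ y) = g y)
    {x y : X} (hx : x ∈ B) (hy : y ∈ B) (hxy : φ x < φ y) :
    (u x - u y).abs ≤ ∫⁻ t in Ioc (φ x) (φ y), G t := by
  have : Nonempty X := ⟨x⟩
  have hmem : ∀ τ ∈ Icc 0 (φ y - φ x), φ x + τ ∈ φ '' B := fun τ hτ =>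
    hconn.out (mem_image_of_mem φ hx) (mem_image_of_mem φ hy)
      ⟨by linarith [hτ.1], by linarith [hτ.2]⟩
  set γ : ℝ → X := fun τ => Function.invFunOn φ B (φ x + τ) with hγ
  have hφγ : ∀ τ ∈ Icc 0 (φ y - φ x), φ (γ τ) = φ x + τ := fun τ hτ =>
    Function.invFunOn_eq (hmem τ hτ)
  have hγB : MapsTo γ (Icc 0 (φ y - φ x)) B := fun τ hτ => Function.invFunOn_mem (hmem τ hτ)
  have hunit : HasUnitSpeedOn γ (Icc 0 (φ y - φ x)) := by
    refine hasUnitSpeedOn_of_edist_eq fun s hs t ht => ?_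
    rw [← hφ.edist_eq, hφγ s hs, hφγ t ht, edist_dist, edist_dist, dist_add_left]
  have h := hg.2 (φ y - φ x) γ (by linarith) hunit hγB
  have h0 : γ 0 = x := hφ.injective (by rw [hφγ 0 ⟨le_rfl, by linarith⟩, add_zero])
  have h1 : γ (φ y - φ x) = y :=
    hφ.injective (by rw [hφγ _ ⟨by linarith, le_rfl⟩, add_sub_cancel])
  rw [h0, h1] at h
  refine h.trans_eq ?_
  have h2 := (measurePreserving_add_left volume (φ x)).setLIntegral_comp_preimage_emb
    (measurableEmbedding_addLeft _) G (Icc (φ x) (φ y))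
  rw [preimage_const_add_Icc, sub_self] at h2
  rw [setLIntegral_congr Ioc_ae_eq_Icc, ← h2]
  refine setLIntegral_congr_fun measurableSet_Icc fun τ hτ => ?_
  rw [← hφγ τ hτ, hG _ (hγB hτ)]

theorem enorm_toReal_sub_le_lintegral_uIoc {X : Type*} [MetricSpace X] [MeasurableSpace X]
    {φ : X → ℝ} (hφ : Isometry φ) {B : Set X} (hconn : OrdConnected (φ '' B)) {u : X → EReal}
    {g : X → ℝ≥0∞} (hg : IsUpperGradientOn g u B) {G : ℝ → ℝ≥0∞} (hG : ∀ y ∈ B, G (φ y) = g y)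
    {x y : X} (hx : x ∈ B) (hy : y ∈ B) (hux : u x ≠ ⊤ ∧ u x ≠ ⊥) (huy : u y ≠ ⊤ ∧ u y ≠ ⊥) :
    ‖(u x).toReal - (u y).toReal‖ₑ ≤ ∫⁻ t in uIoc (φ x) (φ y), G t := by
  wlog hxy : φ x ≤ φ y generalizing x y
  · rw [enorm_sub_rev, uIoc_comm]
    exact this hy hx huy hux (le_of_not_ge hxy)
  rcases hxy.eq_or_lt with heq | hlt
  · simp [hφ.injective heq]
  rw [uIoc_of_le hxy]
  refine le_trans (le_of_eq ?_) (abs_sub_le_lintegral_Ioc_of_isometry hφ hconn hg hG hx hy hlt)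
  conv_rhs => rw [← EReal.coe_toReal hux.1 hux.2, ← EReal.coe_toReal huy.1 huy.2]
  rw [← EReal.coe_sub, EReal.abs_def, ← ofReal_norm, Real.norm_eq_abs]

/-- Stated for an isometric embedding so as to cover both `[0, 1]` as a space of its own (inclusion)
and intervals of the line (identity). -/
theorem poincareOnBall_one_two_of_isometry {X : Type*} [MetricSpace X] [MeasurableSpace X]
    [OpensMeasurableSpace X] {α : ℝ} (hα : 0 ≤ α) {m : Measure X} {φ : X → ℝ} (hφ : Isometry φ)
    (hφm : MeasurableEmbedding φ) {x : X} {r a b : ℝ} (ha : 0 ≤ a) (hb : b ≤ 1)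
    (hab : b - a ≤ 2 * r) (hB : φ '' ball x r ⊆ Icc a b) (hconn : OrdConnected (φ '' ball x r))
    (hmap : (m.restrict (ball x r)).map φ = (powerMeasure α).restrict (φ '' ball x r))
    (hpos : m (ball x r) ≠ 0) : PoincareOnBall m 1 2 1 x r := by
  intro u g hu hg
  rw [one_mul] at hu hg ⊢
  simp only [ENNReal.rpow_one, div_one]
  set B := ball x r
  have hBm : MeasurableSet B := measurableSet_ball
  set S := φ '' B with hS
  have hSm : MeasurableSet S := hφm.measurableSet_image.2 hBm
  have hmE : ∀ E : Set ℝ, MeasurableSet E → m.restrict B (φ ⁻¹' E) = powerMeasure α (S ∩ E) :=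
    fun E hE => by
      rw [← Measure.map_apply hφm.measurable hE, hmap, Measure.restrict_apply hE, inter_comm]
  have hmB : m B = powerMeasure α S := by
    have := hmE univ MeasurableSet.univ
    rwa [preimage_univ, Measure.restrict_apply_univ, inter_univ] at this
  have hfin : m B ≠ ∞ := by rw [hmB]; exact (powerMeasure_lt_top hα S).ne
  set G : ℝ → ℝ≥0∞ := Function.extend φ (B.indicator g) 0 with hGdef
  have hGm : Measurable G := hφm.measurable_extend (hg.1.indicator hBm) measurable_const
  have hG : ∀ y ∈ B, G (φ y) = g y := fun y hy => by
    rw [hGdef, hφ.injective.extend_apply, indicator_of_mem hy]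
  have hG0 : ∀ t, t ∉ S → G t = 0 := fun t ht => by
    by_cases h : ∃ y, φ y = t
    · obtain ⟨y, rfl⟩ := h
      rw [hGdef, hφ.injective.extend_apply, indicator_of_notMem]
      exact fun hy => ht (mem_image_of_mem φ hy)
    · rw [hGdef, Function.extend_apply' _ _ _ h, Pi.zero_apply]
  -- Normalized exactly as in the definition of the average, so that means over `B` unfold to
  -- integrals against `κ`.
  set κ : Measure X := (m.restrict B univ)⁻¹ • m.restrict B with hκ
  have hκp : IsProbabilityMeasure κ := ⟨by
    rw [hκ, Measure.smul_apply, smul_eq_mul, Measure.restrict_apply_univ,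
      ENNReal.inv_mul_cancel hpos hfin]⟩
  have hκB : ∀ {P : X → Prop}, (∀ᵐ y ∂(m.restrict B), P y) → ∀ᵐ y ∂κ, P y := fun h =>
    Measure.ae_smul_measure h _
  have hfinite := hκB hu.1
  have hmemB : ∀ᵐ y ∂κ, y ∈ B := hκB (ae_restrict_mem hBm)
  set f : X → ℝ := fun y => (u y).toReal with hf
  have hfi : Integrable f κ := hu.2.smul_measure (by
    rw [Measure.restrict_apply_univ]; exact ENNReal.inv_ne_top.2 hpos)
  have hmean : meanOn u B m = ∫ y, f y ∂κ := rfl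
  have hpair : ∀ᵐ y ∂κ, ∀ᵐ z ∂κ, ‖f y - f z‖ₑ ≤ ∫⁻ t in uIoc (φ y) (φ z), G t := by
    filter_upwards [hfinite, hmemB] with y hy hyB
    filter_upwards [hfinite, hmemB] with z hz hzB
    exact enorm_toReal_sub_le_lintegral_uIoc hφ hconn hg hG hyB hzB hy hz
  have hweight : ∀ t, G t * (2 * (κ (φ ⁻¹' Iio t) * κ (φ ⁻¹' Ici t))) ≤
      (ENNReal.ofReal (b - a) * (m B)⁻¹) * (powerWeight α t * G t) := fun t => by
    by_cases ht : t ∈ S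
    · have h := two_mul_powerMeasure_mul_le hα ha hb hB (hB ht)
      rw [hκ, Measure.smul_apply, Measure.smul_apply, hmE _ measurableSet_Iio,
        hmE _ measurableSet_Ici, Measure.restrict_apply_univ, smul_eq_mul, smul_eq_mul]
      rw [← hmB] at h
      calc G t * (2 * ((m B)⁻¹ * powerMeasure α (S ∩ Iio t) *
              ((m B)⁻¹ * powerMeasure α (S ∩ Ici t))))
          = G t * ((m B)⁻¹ * (m B)⁻¹) * (2 * (powerMeasure α (S ∩ Iio t) *
              powerMeasure α (S ∩ Ici t))) := by ring
        _ ≤ G t * ((m B)⁻¹ * (m B)⁻¹) * (ENNReal.ofReal (b - a) * powerWeight α t * m B) := by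
            gcongr
        _ = (ENNReal.ofReal (b - a) * (m B)⁻¹) * (powerWeight α t * G t) *
              ((m B)⁻¹ * m B) := by ring
        _ = _ := by rw [ENNReal.inv_mul_cancel hpos hfin, mul_one]
    · simp [hG0 t ht]
  have hint : ∫⁻ t, powerWeight α t * G t = ∫⁻ y in B, g y ∂m := by
    calc ∫⁻ t, powerWeight α t * G t = ∫⁻ t, G t ∂(powerMeasure α) := by
          rw [powerMeasure, lintegral_withDensity_eq_lintegral_mul _ (measurable_powerWeight α) hGm]
          rfl
      _ = ∫⁻ t in S, G t ∂(powerMeasure α) := by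
          rw [← lintegral_indicator hSm]
          refine lintegral_congr fun t => ?_
          by_cases ht : t ∈ S
          · rw [indicator_of_mem ht]
          · rw [indicator_of_notMem ht, hG0 t ht]
      _ = ∫⁻ y in B, G (φ y) ∂m := by rw [← hmap, lintegral_map hGm hφm.measurable]
      _ = ∫⁻ y in B, g y ∂m := setLIntegral_congr_fun hBm hG
  calc ⨍⁻ y in B, (u y - (meanOn u B m : EReal)).abs ∂m
      = ∫⁻ y, (u y - (meanOn u B m : EReal)).abs ∂κ := rfl
    _ = ∫⁻ y, ‖f y - ∫ z, f z ∂κ‖ₑ ∂κ := by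
        refine lintegral_congr_ae (hfinite.mono fun y hy => ?_)
        dsimp only
        rw [hmean, ← ofReal_norm, Real.norm_eq_abs, ← EReal.abs_def, EReal.coe_sub, hf,
          EReal.coe_toReal hy.1 hy.2]
    _ ≤ ∫⁻ y, ∫⁻ z, ‖f y - f z‖ₑ ∂κ ∂κ := lintegral_enorm_sub_integral_le hfi
    _ ≤ ∫⁻ t, G t * (2 * (κ (φ ⁻¹' Iio t) * κ (φ ⁻¹' Ici t))) :=
        lintegral_lintegral_le_of_le_lintegral_uIoc hφm.measurable hGm hpair
    _ ≤ ∫⁻ t, (ENNReal.ofReal (b - a) * (m B)⁻¹) * (powerWeight α t * G t) := lintegral_mono hweight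
    _ = ENNReal.ofReal (b - a) * (m B)⁻¹ * ∫⁻ y in B, g y ∂m := by
        rw [← hint]
        exact lintegral_const_mul _ ((measurable_powerWeight α).mul hGm)
    _ ≤ ENNReal.ofReal (2 * r) * ⨍⁻ y in B, g y ∂m := by
        rw [setLAverage_eq, ENNReal.div_eq_inv_mul, mul_assoc]
        gcongr

/-- Hölder's inequality for the normalized measure on the dilated ball. -/
theorem PoincareOnBall.of_one {X : Type*} [MetricSpace X] [MeasurableSpace X] {m : Measure X}
    {p C lam : ℝ} {x : X} {r : ℝ} (hp : 1 ≤ p) (h : PoincareOnBall m 1 C lam x r)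
    (h0 : m (ball x (lam * r)) ≠ 0) (hfin : m (ball x (lam * r)) ≠ ∞) :
    PoincareOnBall m p C lam x r := by
  intro u g hu hg
  refine (h u g hu hg).trans ?_
  gcongr
  have : IsProbabilityMeasure ((m.restrict (ball x (lam * r)) univ)⁻¹ •
      m.restrict (ball x (lam * r))) := ⟨by
    rw [Measure.smul_apply, smul_eq_mul, Measure.restrict_apply_univ,
      ENNReal.inv_mul_cancel h0 hfin]⟩
  have key := eLpNorm'_le_eLpNorm'_of_exponent_le one_pos hp
    ((m.restrict (ball x (lam * r)) univ)⁻¹ • m.restrict (ball x (lam * r)))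
    hg.1.aestronglyMeasurable
  simp only [eLpNorm', enorm_eq_self] at key
  exact key

/-! ### Doubling and Poincaré on the metric space `[0, 1]` -/

theorem restrict_map_val_powerMeasureUnit (α : ℝ) (B : Set (Icc (0 : ℝ) 1)) :
    ((powerMeasureUnit α).restrict B).map Subtype.val =
      (powerMeasure α).restrict (Subtype.val '' B) := by
  have he : MeasurableEmbedding (Subtype.val : Icc (0 : ℝ) 1 → ℝ) :=
    MeasurableEmbedding.subtype_coe measurableSet_Icc
  ext E hE
  rw [Measure.map_apply he.measurable hE, Measure.restrict_apply (he.measurable hE),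
    powerMeasureUnit, he.comap_apply, Measure.restrict_apply hE, image_preimage_inter]

theorem powerMeasureUnit_apply (α : ℝ) (B : Set (Icc (0 : ℝ) 1)) :
    powerMeasureUnit α B = powerMeasure α (Subtype.val '' B) :=
  (MeasurableEmbedding.subtype_coe measurableSet_Icc).comap_apply _ _

theorem image_val_ball (x : Icc (0 : ℝ) 1) (r : ℝ) :
    Subtype.val '' ball x r = Icc 0 1 ∩ Ioo ((x : ℝ) - r) (x + r) := by
  rw [← Real.ball_eq_Ioo]
  ext y
  constructor
  · rintro ⟨z, hz, rfl⟩
    exact ⟨z.2, hz⟩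
  · rintro ⟨hy, hz⟩
    exact ⟨⟨y, hy⟩, hz, rfl⟩

theorem supportsPoincareWith_powerMeasureUnit {α : ℝ} (hα : 0 ≤ α) :
    SupportsPoincareWith (powerMeasureUnit α) 1 2 1 := by
  intro x₀ r₀ _ x r hr _
  have hx := x.2
  refine poincareOnBall_one_two_of_isometry hα (a := max 0 (x - r)) (b := min 1 (x + r))
    isometry_subtype_coe (MeasurableEmbedding.subtype_coe measurableSet_Icc) (le_max_left _ _)
    (min_le_left _ _) ?_ ?_ ?_ (restrict_map_val_powerMeasureUnit α _) ?_
  · linarith [min_le_right 1 ((x : ℝ) + r), le_max_right 0 ((x : ℝ) - r)]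
  · rw [image_val_ball]
    exact fun y hy => ⟨max_le hy.1.1 hy.2.1.le, le_min hy.1.2 hy.2.2.le⟩
  · rw [image_val_ball]
    exact ordConnected_Icc.inter ordConnected_Ioo
  · rw [powerMeasureUnit_apply, image_val_ball]
    refine ((powerMeasure_Ioo_pos hα (le_max_left 0 ((x : ℝ) - r)) (b := min 1 (x + r)) ?_
      (min_le_left _ _)).trans_le (measure_mono fun y hy => ?_)).ne'
    · refine max_lt (lt_min one_pos (by linarith [hx.1])) (lt_min ?_ ?_) <;> linarith [hx.2]
    · obtain ⟨h1, h2⟩ := hy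
      rw [max_lt_iff] at h1
      rw [lt_min_iff] at h2
      exact ⟨⟨h1.1.le, h2.1.le⟩, h1.2, h2.2⟩

theorem isDoubling_powerMeasureUnit {α : ℝ} (hα : 0 ≤ α) : IsDoubling (powerMeasureUnit α) := by
  refine ⟨16 * 12 ^ α, by positivity, fun x₀ r₀ _ x r hr _ => ?_⟩
  have hx := x.2
  rw [powerMeasureUnit_apply, powerMeasureUnit_apply, image_val_ball, image_val_ball]
  -- Radii above 1 add nothing in `[0, 1]`, so `r` is capped at 1. The doubled ball has measure at
  -- most `4ρ (x + 2ρ) ^ α`; the ball contains an interval of length `ρ / 4` on which points are at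
  -- least `(x + 2ρ) / 12`. The quotient is `16 * 12 ^ α`.
  obtain ⟨ρ, hρ0, hρr, hρ1, hρ⟩ : ∃ ρ : ℝ, 0 < ρ ∧ ρ ≤ r ∧ ρ ≤ 1 ∧ (ρ = r ∨ ρ = 1) :=
    ⟨min r 1, lt_min hr one_pos, min_le_left _ _, min_le_right _ _, min_choice _ _⟩
  have hupper : powerMeasure α (Icc 0 1 ∩ Ioo ((x : ℝ) - 2 * r) (x + 2 * r)) ≤
      ENNReal.ofReal ((x + 2 * ρ - (x - 2 * ρ)) * (x + 2 * ρ) ^ α) := by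
    refine powerMeasure_le hα fun y hy => ?_
    rcases hρ with h | h
    · rw [h]; exact Ioo_subset_Icc_self hy.2
    · constructor <;> linarith [hy.1.1, hy.1.2, hx.1, hx.2]
  have hlower : ENNReal.ofReal (ρ / 4 * ((x + 2 * ρ) / 12) ^ α) ≤
      powerMeasure α (Icc 0 1 ∩ Ioo ((x : ℝ) - r) (x + r)) := by
    obtain ⟨c, hc1, hc2, hc3, hc4⟩ : ∃ c : ℝ, (x + 2 * ρ) / 12 ≤ c ∧ c + ρ / 4 ≤ 1 ∧ x - r ≤ c ∧
        c + ρ / 4 ≤ x + r := by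
      -- The interval lies to the right of `x` unless `x` is close to 1; in that case points beyond
      -- `x - ρ / 4` are at least `1 / 4`, while `(x + 2ρ) / 12 ≤ 1 / 4`.
      rcases le_total (x : ℝ) (1 / 2) with h | h
      · exact ⟨x + ρ / 4, by linarith [hx.1], by linarith, by linarith, by linarith⟩
      · exact ⟨x - ρ / 4, by linarith, by linarith [hx.2], by linarith, by linarith⟩
    have hc0 : 0 ≤ (x + 2 * ρ) / 12 := by linarith [hx.1]
    refine le_trans ?_ ((le_powerMeasure hα (hc0.trans hc1) hc2).trans
      (measure_mono fun y hy => ?_))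
    · rw [add_sub_cancel_left]
      exact ENNReal.ofReal_le_ofReal (by gcongr)
    · exact ⟨⟨by linarith [hy.1], by linarith [hy.2]⟩, by linarith [hy.1], by linarith [hy.2]⟩
  refine hupper.trans (le_trans ?_ (mul_le_mul_right hlower _))
  rw [← ENNReal.ofReal_mul (by positivity)]
  refine ENNReal.ofReal_le_ofReal (le_of_eq ?_)
  rw [Real.div_rpow (by linarith [hx.1]) (by norm_num)]
  field_simp
  ring

/-! ### Admissibility within `(0, 1)` and the final assembly -/

theorem bounds_of_ball_subset {x r : ℝ} (hr : 0 < r)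
    (h : ball x r ⊆ ball (1 / 2 : ℝ) (1 / 2)) : 0 ≤ x - r ∧ x + r ≤ 1 := by
  rw [Real.ball_eq_Ioo, Real.ball_eq_Ioo, Ioo_subset_Ioo_iff (by linarith)] at h
  constructor <;> linarith [h.1, h.2]

theorem powerMeasure_ball_pos {α : ℝ} (hα : 0 ≤ α) {x r : ℝ} (hr : 0 < r)
    (h : ball x r ⊆ ball (1 / 2 : ℝ) (1 / 2)) : 0 < powerMeasure α (ball x r) := by
  obtain ⟨h0, h1⟩ := bounds_of_ball_subset hr h
  rw [Real.ball_eq_Ioo]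
  exact powerMeasure_Ioo_pos hα h0 (by linarith) h1

theorem poincareWithinWith_powerMeasure {α : ℝ} (hα : 0 ≤ α) :
    PoincareWithinWith (powerMeasure α) 1 2 1 (1 / 2) (1 / 2) := by
  intro x r hr hsub
  obtain ⟨h0, h1⟩ := bounds_of_ball_subset hr hsub
  refine poincareOnBall_one_two_of_isometry hα isometry_id MeasurableEmbedding.id h0 h1
    (by linarith) ?_ ?_ ?_ (powerMeasure_ball_pos hα hr hsub).ne'
  · rw [image_id, Real.ball_eq_Ioo]
    exact Ioo_subset_Icc_self
  · rw [image_id, Real.ball_eq_Ioo]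
    exact ordConnected_Ioo
  · rw [image_id, Measure.map_id]

theorem admissibleWithin_powerMeasure {α : ℝ} (hα : 0 ≤ α) {p : ℝ} (hp : 1 ≤ p) :
    AdmissibleWithin (powerMeasure α) p (1 / 2) (1 / 2) := by
  refine ⟨⟨4 * 3 ^ α, by positivity, fun x r hr hsub => ?_⟩,
    ⟨2, 1, two_pos, le_rfl, fun x r hr hsub => ?_⟩⟩
  · obtain ⟨h0, h1⟩ := bounds_of_ball_subset hr hsub
    have hx : 0 < x := by linarith
    have hupper : powerMeasure α (ball x (2 * r)) ≤
        ENNReal.ofReal ((x + 2 * r - (x - 2 * r)) * (x + 2 * r) ^ α) := by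
      rw [Real.ball_eq_Ioo]
      exact powerMeasure_le hα Ioo_subset_Icc_self
    have hlower : ENNReal.ofReal ((x + r - x) * x ^ α) ≤ powerMeasure α (ball x r) := by
      rw [Real.ball_eq_Ioo]
      exact (le_powerMeasure hα hx.le h1).trans
        (measure_mono (Ioo_subset_Ioo_left (by linarith)))
    refine hupper.trans (le_trans ?_ (mul_le_mul_right hlower _))
    rw [← ENNReal.ofReal_mul (by positivity)]
    refine ENNReal.ofReal_le_ofReal ?_
    -- The ball lies in `(0, 1)`, so `r ≤ x` and `x + 2r ≤ 3x`; the lower bound uses only the right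
    -- half `(x, x + r)`.
    calc (x + 2 * r - (x - 2 * r)) * (x + 2 * r) ^ α ≤ 4 * r * (3 * x) ^ α := by
          rw [show x + 2 * r - (x - 2 * r) = 4 * r by ring]
          gcongr
          linarith
      _ = 4 * 3 ^ α * ((x + r - x) * x ^ α) := by
          rw [Real.mul_rpow (by norm_num) hx.le]
          ring
  · refine (poincareWithinWith_powerMeasure hα x r hr hsub).of_one hp ?_
      (powerMeasure_lt_top hα _).ne
    rw [one_mul]
    exact (powerMeasure_ball_pos hα hr hsub).ne'

theorem mainTheorem7 (α : ℝ) (hα : 0 ≤ α) :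
    -- on the metric space `[0, 1]`: doubling, and a 1-Poincaré inequality with constant 2
    (IsDoubling (powerMeasureUnit α) ∧ SupportsPoincareWith (powerMeasureUnit α) 1 2 1) ∧
    -- the same constant for all intervals `(a, b) ⊆ (0, 1)` of the real line
    PoincareWithinWith (powerMeasure α) 1 2 1 (1 / 2) (1 / 2) ∧
    -- `p`-admissible within `(0, 1)`
    (∀ p : ℝ, 1 ≤ p → AdmissibleWithin (powerMeasure α) p (1 / 2) (1 / 2)) ∧
    (∀ p : ℝ, 1 ≤ p → p < 1 + α →
      -- not an `A_p` weight within `(0, 1)`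
      ¬ IsApWeightWithin (powerWeight α) p (1 / 2) (1 / 2) ∧
      -- no extension to the real line supports a `p`-Poincaré inequality
      (∀ ν : Measure ℝ, PosFiniteOnBalls ν → ν.restrict (Icc 0 1) = powerMeasure α →
        (∀ C lam : ℝ, 0 < C → 1 ≤ lam → ¬ PoincareOnBall ν p C lam 0 1) ∧
        (∀ r : ℝ, 0 < r → ¬ PoincareWithin ν p 0 r) ∧
        ¬ SupportsPoincare ν p) ∧
      -- in particular the reflected measures, on the line and on the circle, do not either
      ¬ SupportsPoincare (volume.withDensity (periodicReflection (powerWeight α) 1)) p ∧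
      ¬ SupportsPoincare (circleReflection (powerMeasure α) 1) p) := by

  refine ⟨⟨isDoubling_powerMeasureUnit hα, supportsPoincareWith_powerMeasureUnit hα⟩,
    poincareWithinWith_powerMeasure hα, fun p hp => admissibleWithin_powerMeasure hα hp,
    fun p hp hpα => ⟨not_isApWeightWithin_powerWeight hp hpα, fun ν hb hν => ⟨?_, ?_, ?_⟩,
      not_supportsPoincare_periodicReflection hα hp hpα,
      not_supportsPoincare_circleReflection hα hp hpα⟩⟩
  · exact fun C lam _ hlam => not_poincareOnBall_of_posFiniteOnBalls hα hp hpα hb hν hlam one_pos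
  · rintro r hr ⟨C, lam, _, hlam, h⟩
    exact not_poincareOnBall_of_posFiniteOnBalls hα hp hpα hb hν hlam hr (h 0 r hr subset_rfl)
  · rintro ⟨C, lam, _, hlam, h⟩
    exact not_poincareOnBall_of_posFiniteOnBalls hα hp hpα hb hν hlam one_pos
      (h 0 1 one_pos 0 1 one_pos subset_rfl)
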